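/- Let $X$ be a (real or complex) Banach space with bounded operators $\mathcal B(X)$. Let $\mu=(\mu_n)_{n\in\mathbb Z}$ be a growth rate, i.e. a strictly increasing sequence of positive numbers with $\lim_{n\to+\infty}\mu_n=+\infty$ and $\lim_{n\to-\infty}\mu_n=0$, and let $\nu=(\nu_n)_{n\in\mathbb Z}$ be a sequence of real numbers with $\nu_n\ge 1$ for all $n$. For a sequence $(A_n)_{n\in\mathbb Z}$ in $\mathcal B(X)$ put $\mathcal A(m,n)=A_{m-1}\cdots A_n$ for $m>n$ and $\mathcal A(n,n)=\mathrm{Id}$. The equation $x_{n+1}=A_nx_n$, $n\in\mathbb Z$, is said to admit a $(\mu,\nu)$-dichotomy if there are bounded projections $P_n$, $n\in\mathbb Z$, on $X$ and constants $D,\lambda>0$ such that: $A_nP_n=P_{n+1}A_n$ for all $n$; the restriction $A_n|_{\operatorname{Ker}P_n}:\operatorname{Ker}P_n\to\operatorname{Ker}P_{n+1}$ is invertible for all $n$; and $$\|\mathcal A(m,n)P_n\|\le D\nu_n\Big(\frac{\mu_m}{\mu_n}\Big)^{-\lambda}\ (m\ge n),\qquad \|\mathcal A(m,n)(\mathrm{Id}-P_n)\|\le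 D\nu_n\Big(\frac{\mu_n}{\mu_m}\Big)^{-\lambda}\ (m\le n),$$ where for $m\le n$, in the second estimate, $\mathcal A(m,n):=\big(\mathcal A(n,m)|_{\operatorname{Ker}P_m}\big)^{-1}:\operatorname{Ker}P_n\to\operatorname{Ker}P_m$. **Theorem.** Suppose that $x_{n+1}=A_nx_n$, $n\in\mathbb Z$, admits a $(\mu,\nu)$-dichotomy for which the above estimates hold with the constant $\lambda>0$, and that for some $\varepsilon\in[0,\lambda)$ $$\sup_{n\in\mathbb N}\big(\mu_{-n}^{\varepsilon}\nu_{-n}\big)<+\infty\quad\text{and}\quad \sup_{n\in\mathbb N}\big(\mu_n^{-\varepsilon}\nu_n\big)<+\infty.$$ Let $\beta\in(0,\lambda-\varepsilon)$ and let $(\gamma_n)_{n\in\mathbb Z}$ be a sequence of positive numbers with $\sum_{n\in\mathbb Z}\gamma_n<+\infty$. Then there is $c_0>0$ such that for every $c\in(0,c_0]$ and every sequence $(B_n)_{n\in\mathbb Z}$ in $\mathcal B(X)$ with $$\|B_n\|\le\frac{c\,\gamma_n\,\mu_n^{\beta}}{\nu_{n+1}\,\mu_{n+1}^{\beta}}\qquad\text{for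 all } n\in\mathbb Z,$$ the equation $x_{n+1}=(A_n+B_n)x_n$, $n\in\mathbb Z$, also admits a $(\mu,\nu)$-dichotomy. -/

import Mathlib

open Filter Topology

namespace MuNu

/-- A (two-sided) growth rate: a strictly increasing sequence of positive reals, indexed by `ℤ`,
tending to `+∞` at `+∞` and to `0` at `-∞`. -/
structure IsGrowthRate (μ : ℤ → ℝ) : Prop where
  pos : ∀ n, 0 < μ n
  strictMono : StrictMono μ
  tendsto_atTop : Tendsto μ atTop atTop
  tendsto_atBot : Tendsto μ atBot (𝓝 0)

section

variable {𝕜 X : Type*} [RCLike 𝕜] [NormedAddCommGroup X] [NormedSpace 𝕜 X]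

/-- `iter A n k = A_{n+k-1} ⋯ A_n` (the identity for `k = 0`). -/
def iter (A : ℤ → X →L[𝕜] X) (n : ℤ) : ℕ → X →L[𝕜] X
  | 0 => ContinuousLinearMap.id 𝕜 X
  | k + 1 => (A (n + k)).comp (iter A n k)

/-- The forward evolution operator `𝒜(m, n) = A_{m-1} ⋯ A_n` for `m > n` and
`𝒜(n, n) = Id`; it is only used for `m ≥ n`. -/
def evol (A : ℤ → X →L[𝕜] X) (m n : ℤ) : X →L[𝕜] X :=
  iter A n (m - n).toNat

/-- If `T P = Q T`, the restriction `T|_{Ker P} : Ker P → Ker Q`. -/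
def kerRestrict (T P Q : X →L[𝕜] X) (h : T.comp P = Q.comp T) :
    P.ker →L[𝕜] Q.ker :=
  (T.comp P.ker.subtypeL).codRestrict Q.ker (fun v => by
    have h1 : P (v : X) = 0 := v.2
    have h2 : T (P (v : X)) = Q (T (v : X)) := DFunLike.congr_fun h (v : X)
    rw [h1, map_zero] at h2
    exact h2.symm)

/-- For a projection `P`, the operator `Id - P` as a map `X → Ker P`. -/
def complProj (P : X →L[𝕜] X) (h : P.comp P = P) : X →L[𝕜] P.ker :=
  (ContinuousLinearMap.id 𝕜 X - P).codRestrict P.ker (fun v => by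
    have h2 : P (P v) = P v := DFunLike.congr_fun h v
    change P (v - P v) = 0
    rw [map_sub, h2, sub_self])

theorem iter_comm {A P : ℤ → X →L[𝕜] X}
    (h : ∀ n, (A n).comp (P n) = (P (n + 1)).comp (A n)) (n : ℤ) (k : ℕ) :
    (iter A n k).comp (P n) = (P (n + k)).comp (iter A n k) := by
  induction k with
  | zero => ext v; simp [iter]
  | succ k ih =>
    have e : n + ((k + 1 : ℕ) : ℤ) = n + k + 1 := by push_cast; ring
    rw [e]
    simp only [iter]
    rw [ContinuousLinearMap.comp_assoc, ih, ← ContinuousLinearMap.comp_assoc, h,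
      ContinuousLinearMap.comp_assoc]

theorem evol_comm {A P : ℤ → X →L[𝕜] X}
    (h : ∀ n, (A n).comp (P n) = (P (n + 1)).comp (A n)) {m n : ℤ} (hmn : m ≤ n) :
    (evol A n m).comp (P m) = (P n).comp (evol A n m) := by
  have e : m + ((n - m).toNat : ℤ) = n := by omega
  have := iter_comm h m (n - m).toNat
  rw [e] at this
  exact this

/-- The backward evolution operator
`𝒜(m, n) = (𝒜(n, m)|_{Ker P_m})⁻¹ : Ker P_n → Ker P_m` for `m ≤ n`.
In the definition of a dichotomy the operator being inverted is invertible, so that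
`ContinuousLinearMap.inverse` is its true inverse. -/
noncomputable def backEvol (A P : ℤ → X →L[𝕜] X)
    (h : ∀ n, (A n).comp (P n) = (P (n + 1)).comp (A n)) {m n : ℤ} (hmn : m ≤ n) :
    (P n).ker →L[𝕜] (P m).ker :=
  (kerRestrict (evol A n m) (P m) (P n) (evol_comm h hmn)).inverse

/-- The equation `x_{n+1} = A_n x_n`, `n ∈ ℤ`, admits a `(μ, ν)`-dichotomy with respect to the
projections `P_n`, with constants `D` and `lam`. -/
structure IsDichotomy (μ ν : ℤ → ℝ) (A P : ℤ → X →L[𝕜] X) (D lam : ℝ) : Prop where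
  D_pos : 0 < D
  lam_pos : 0 < lam
  proj : ∀ n, (P n).comp (P n) = P n
  comm : ∀ n, (A n).comp (P n) = (P (n + 1)).comp (A n)
  invertible : ∀ n, (kerRestrict (A n) (P n) (P (n + 1)) (comm n)).IsInvertible
  stable : ∀ m n : ℤ, n ≤ m →
    ‖(evol A m n).comp (P n)‖ ≤ D * ν n * (μ m / μ n) ^ (-lam)
  unstable : ∀ (m n : ℤ) (hmn : m ≤ n),
    ‖(P m).ker.subtypeL.comp ((backEvol A P comm hmn).comp (complProj (P n) (proj n)))‖
      ≤ D * ν n * (μ n / μ m) ^ (-lam)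

/-- The equation `x_{n+1} = A_n x_n`, `n ∈ ℤ`, admits a `(μ, ν)`-dichotomy. -/
def AdmitsDichotomy (μ ν : ℤ → ℝ) (A : ℤ → X →L[𝕜] X) : Prop :=
  ∃ (P : ℤ → X →L[𝕜] X) (D lam : ℝ), IsDichotomy μ ν A P D lam

end

end MuNu

/-! A dichotomy is encoded by its Green function `G`: `𝒜(m,n)P_n` for `m ≥ n` and minus the backward
evolution of `Id - P_n` for `m < n`. In the variable `log μ` both estimates become one: exponential
decay in `|log μ_m - log μ_n|`, up to the factor `ν_n`. The perturbed Green function `H` should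
solve `H(m,n) = G(m,n) + ∑ₖ G(m,k+1) B_k H(k,n)`. In the sup norm weighted by `exp(-β|log μ_m - t|)`
this kernel has norm at most `1/2` for every centre `t` (`IsDichotomy.kernelBound`), so a Neumann
series gives `H`, and `t = log μ_n` gives its decay at rate `β`. The algebra of `H` comes from
uniqueness: the perturbed equation has no nonzero solution dominated by the weight centred at `0`
(`IsGreen.noSmallSolution_add`). This yields the right recursion (`IsGreen.of_left`) and the
idempotence of `H(n,n)` (`IsGreen.mul_diag`). A Green function with these properties is a dichotomy
with projections `H(n,n)` (`IsGreen.isDichotomy`). -/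

namespace MuNu

/-! ### Green functions and uniqueness of dominated solutions -/

section Ring

variable {R : Type*} [NormedRing R]

/-- A two-sided Green function of the equation `x_{n+1} = A_n x_n`. -/
structure IsGreen (A : ℤ → R) (G : ℤ → ℤ → R) : Prop where
  left : ∀ m n, G (m + 1) n = A m * G m n + if m + 1 = n then 1 else 0
  right : ∀ m n, G m n = G m (n + 1) * A n + if m = n then 1 else 0

/-- The equation `x_{n+1} = A_n x_n` has no nonzero solution dominated by the weight `w`. -/
def NoSmallSolution (A : ℤ → R) (w : ℤ → ℝ) : Prop :=
  ∀ x : ℤ → R, (∀ m, x (m + 1) = A m * x m) → (∃ C, ∀ m, ‖x m‖ ≤ C * w m) → ∀ m, x m = 0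

/-- By the right recursion, `n ↦ G m n * x n` is constant for `n ≤ m` and for `n ≥ m + 1`, with jump
`x m` in between. Both constants are limits equal to `0`. -/
theorem IsGreen.noSmallSolution {A : ℤ → R} {G : ℤ → ℤ → R} (hG : IsGreen A G)
    {w : ℤ → ℝ} (htop : ∀ m, Tendsto (fun n => ‖G m n‖ * w n) atTop (𝓝 0))
    (hbot : ∀ m, Tendsto (fun n => ‖G m n‖ * w n) atBot (𝓝 0)) : NoSmallSolution A w := by
  rintro x hx ⟨C, hC⟩ m
  have step : ∀ n, G m n * x n = G m (n + 1) * x (n + 1) + if m = n then x m else 0 := by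
    intro n
    rw [hx n, hG.right m n, add_mul, mul_assoc]
    split_ifs with h
    · rw [one_mul, h]
    · rw [zero_mul]
  have lim : ∀ l : Filter ℤ, Tendsto (fun n => ‖G m n‖ * w n) l (𝓝 0) →
      Tendsto (fun n => G m n * x n) l (𝓝 0) := by
    intro l hl
    refine squeeze_zero_norm (a := fun n => C * (‖G m n‖ * w n)) (fun n => ?_) ?_
    · calc ‖G m n * x n‖ ≤ ‖G m n‖ * ‖x n‖ := norm_mul_le _ _
        _ ≤ ‖G m n‖ * (C * w n) := mul_le_mul_of_nonneg_left (hC n) (norm_nonneg _)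
        _ = C * (‖G m n‖ * w n) := by ring
    · simpa using hl.const_mul C
  have hup : ∀ n, m + 1 ≤ n → G m n * x n = G m (m + 1) * x (m + 1) := by
    intro n hn
    induction n, hn using Int.leInduction with
    | base => rfl
    | succ n hn ih => rw [← ih, step n, if_neg (by omega), add_zero]
  have hdown : ∀ n, n ≤ m → G m n * x n = G m m * x m := by
    intro n hn
    induction n, hn using Int.leInductionDown with
    | base => rfl
    | pred n hn ih =>
      rw [← ih, step (n - 1), if_neg (by omega), add_zero, sub_add_cancel]
  have h1 : G m (m + 1) * x (m + 1) = 0 :=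
    tendsto_nhds_unique (tendsto_const_nhds.congr' (by
      filter_upwards [eventually_ge_atTop (m + 1)] with n hn using (hup n hn).symm))
      (lim _ (htop m))
  have h2 : G m m * x m = 0 :=
    tendsto_nhds_unique (tendsto_const_nhds.congr' (by
      filter_upwards [eventually_le_atBot m] with n hn using (hdown n hn).symm))
      (lim _ (hbot m))
  have := step m
  rw [h1, h2, if_pos rfl, zero_add] at this
  exact this.symm

/-- The kernel `K` is dominated, relative to the weight `w`, by the sequence `g`. -/
def KernelBound (K : ℤ → ℤ → R) (w g : ℤ → ℝ) : Prop :=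
  ∀ m k, ‖K m k‖ * w k ≤ g k * w m

/-! ### Contracting kernels in weighted sup norms -/

section Kernel

variable {K : ℤ → ℤ → R} {w g : ℤ → ℝ} {φ : ℤ → R} {C : ℝ}

theorem KernelBound.norm_mul_le (hK : KernelBound K w g) (hφ : ∀ m, ‖φ m‖ ≤ C * w m)
    (hC : 0 ≤ C) (m k : ℤ) : ‖K m k * φ k‖ ≤ C * w m * g k :=
  calc ‖K m k * φ k‖ ≤ ‖K m k‖ * ‖φ k‖ := _root_.norm_mul_le _ _
    _ ≤ ‖K m k‖ * (C * w k) := mul_le_mul_of_nonneg_left (hφ k) (norm_nonneg _)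
    _ = C * (‖K m k‖ * w k) := by ring
    _ ≤ C * (g k * w m) := mul_le_mul_of_nonneg_left (hK m k) hC
    _ = C * w m * g k := by ring

theorem KernelBound.summable [CompleteSpace R] (hK : KernelBound K w g) (hg : Summable g)
    (hφ : ∀ m, ‖φ m‖ ≤ C * w m) (hC : 0 ≤ C) (m : ℤ) : Summable fun k => K m k * φ k :=
  Summable.of_norm_bounded (hg.mul_left (C * w m)) (hK.norm_mul_le hφ hC m)

theorem KernelBound.norm_tsum_le (hK : KernelBound K w g) (hg : Summable g)
    (hw : ∀ m, 0 < w m) (hg2 : ∑' k, g k ≤ 1 / 2)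
    (hφ : ∀ m, ‖φ m‖ ≤ C * w m) (hC : 0 ≤ C) (m : ℤ) :
    ‖∑' k, K m k * φ k‖ ≤ C / 2 * w m := by
  have h := tsum_of_norm_bounded (hg.hasSum.mul_left (C * w m)) (hK.norm_mul_le hφ hC m)
  refine h.trans ?_
  have := mul_le_mul_of_nonneg_left hg2 (mul_nonneg hC (hw m).le)
  linarith

/-- The kernel halves the weighted norm, so a fixed point is bounded by `C 2⁻ʲ w` for every `j`. -/
theorem KernelBound.eq_zero (hK : KernelBound K w g) (hg : Summable g)
    (hw : ∀ m, 0 < w m) (hg2 : ∑' k, g k ≤ 1 / 2)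
    (hφ : ∀ m, ‖φ m‖ ≤ C * w m) (hfix : ∀ m, φ m = ∑' k, K m k * φ k) (m : ℤ) : φ m = 0 := by
  have hC : 0 ≤ C := by
    have := (norm_nonneg _).trans (hφ 0)
    exact nonneg_of_mul_nonneg_left this (hw 0)
  have hj : ∀ j : ℕ, ∀ m, ‖φ m‖ ≤ C * (1 / 2) ^ j * w m := by
    intro j
    induction j with
    | zero => simpa using hφ
    | succ j ih =>
      intro m
      rw [hfix m]
      refine (hK.norm_tsum_le hg hw hg2 ih (by positivity) m).trans (le_of_eq ?_)
      rw [pow_succ]; ring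
  have hlim : Tendsto (fun j : ℕ => C * (1 / 2 : ℝ) ^ j * w m) atTop (𝓝 0) := by
    have := (tendsto_pow_atTop_nhds_zero_of_lt_one (r := (1 / 2 : ℝ)) (by norm_num)
      (by norm_num)).const_mul C |>.mul_const (w m)
    simpa using this
  exact norm_le_zero_iff.1 (ge_of_tendsto' hlim fun j => hj j m)

theorem KernelBound.exists_solution [CompleteSpace R] (hK : KernelBound K w g) (hg : Summable g)
    (hw : ∀ m, 0 < w m) (hg2 : ∑' k, g k ≤ 1 / 2) {f : ℤ → R}
    (hf : ∀ m, ‖f m‖ ≤ C * w m) :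
    ∃ φ : ℤ → R, (∀ m, ‖φ m‖ ≤ 2 * C * w m) ∧ ∀ m, φ m = f m + ∑' k, K m k * φ k := by
  have hC : 0 ≤ C := by
    have := (norm_nonneg _).trans (hf 0)
    exact nonneg_of_mul_nonneg_left this (hw 0)
  have hg0 : ∀ k, 0 ≤ g k := fun k =>
    nonneg_of_mul_nonneg_left ((mul_nonneg (norm_nonneg _) (hw k).le).trans (hK 0 k)) (hw 0)
  -- Terms of the Neumann series: `u j` is the `j`-fold application of the kernel to `f`.
  let u : ℕ → ℤ → R := fun j => Nat.rec f (fun _ v m => ∑' k, K m k * v k) j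
  have hu0 : u 0 = f := rfl
  have hus : ∀ j m, u (j + 1) m = ∑' k, K m k * u j k := fun _ _ => rfl
  have hu : ∀ j m, ‖u j m‖ ≤ C * (1 / 2) ^ j * w m := by
    intro j
    induction j with
    | zero => simpa [hu0] using hf
    | succ j ih =>
      intro m
      rw [hus]
      refine (hK.norm_tsum_le hg hw hg2 ih (by positivity) m).trans (le_of_eq ?_)
      rw [pow_succ]; ring
  have hgeo : ∀ m, HasSum (fun j : ℕ => C * (1 / 2 : ℝ) ^ j * w m) (2 * C * w m) := by
    intro m
    have := (hasSum_geometric_two.mul_left C).mul_right (w m)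
    rwa [mul_comm C 2] at this
  have hsum : ∀ m, Summable fun j => u j m := fun m =>
    Summable.of_norm_bounded (hgeo m).summable fun j => hu j m
  refine ⟨fun m => ∑' j, u j m, fun m => tsum_of_norm_bounded (hgeo m) fun j => hu j m,
    fun m => ?_⟩
  -- Absolute summability over pairs `(j, k)` allows the two sums to be exchanged.
  have hprod : Summable (Function.uncurry fun (j : ℕ) (k : ℤ) => K m k * u j k) := by
    refine Summable.of_norm_bounded
      ((hgeo m).summable.mul_of_nonneg hg (fun j => ?_) hg0) fun p => ?_
    · have := hw m
      positivity
    · exact hK.norm_mul_le (hu p.1) (by positivity) m p.2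
  change ∑' j, u j m = f m + ∑' k, K m k * ∑' j, u j k
  rw [(hsum m).tsum_eq_zero_add, hu0]
  congr 1
  simp_rw [hus]
  rw [← hprod.tsum_comm]
  exact tsum_congr fun k => (hsum k).tsum_mul_left (K m k)

end Kernel

/-! ### Perturbed equation via variation of constants -/

section Perturbation

variable {A B : ℤ → R} {G : ℤ → ℤ → R} {w g : ℤ → ℝ}

/-- The jump of `G (m + 1) (k + 1)` occurs exactly at `k = m`, which produces the source term `B m *
φ m`. -/
theorem IsGreen.tsum_succ (hG : IsGreen A G) {φ : ℤ → R}
    (hs : ∀ m, Summable fun k => G m (k + 1) * B k * φ k) (m : ℤ) :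
    ∑' k, G (m + 1) (k + 1) * B k * φ k =
      A m * (∑' k, G m (k + 1) * B k * φ k) + B m * φ m := by
  have e : ∀ k, G (m + 1) (k + 1) * B k * φ k =
      A m * (G m (k + 1) * B k * φ k) + if k = m then B m * φ m else 0 := by
    intro k
    rw [hG.left, add_mul, add_mul]
    congr 1
    · simp only [mul_assoc]
    · by_cases h : k = m
      · simp [h]
      · rw [if_neg (by omega), if_neg h, zero_mul, zero_mul]
  simp_rw [e]
  rw [((hs m).mul_left (A m)).tsum_add (hasSum_ite_eq m (B m * φ m)).summable,
    (hs m).tsum_mul_left, tsum_ite_eq]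

theorem IsGreen.exists_perturbed_column [CompleteSpace R] (hG : IsGreen A G)
    (hK : KernelBound (fun m k => G m (k + 1) * B k) w g) (hg : Summable g)
    (hw : ∀ m, 0 < w m) (hg2 : ∑' k, g k ≤ 1 / 2) (n : ℤ) {C : ℝ}
    (hC : ∀ m, ‖G m n‖ ≤ C * w m) :
    ∃ φ : ℤ → R, (∀ m, ‖φ m‖ ≤ 2 * C * w m) ∧
      ∀ m, φ (m + 1) = (A m + B m) * φ m + if m + 1 = n then 1 else 0 := by
  obtain ⟨φ, hφ, hfix⟩ := hK.exists_solution hg hw hg2 hC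
  have hC0 : 0 ≤ 2 * C :=
    nonneg_of_mul_nonneg_left ((norm_nonneg _).trans (hφ 0)) (hw 0)
  refine ⟨φ, hφ, fun m => ?_⟩
  have h := congrArg (A m * ·) (hfix m)
  simp only [mul_add] at h
  rw [hfix (m + 1), hG.left, hG.tsum_succ (hK.summable hg hφ hC0), add_mul, h]
  abel

/-- Subtracting the kernel applied to `x` leaves a small solution of the unperturbed equation, hence
`0`. So `x` is a fixed point of a contraction. -/
theorem IsGreen.noSmallSolution_add [CompleteSpace R] (hG : IsGreen A G)
    (hK : KernelBound (fun m k => G m (k + 1) * B k) w g) (hg : Summable g)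
    (hw : ∀ m, 0 < w m) (hg2 : ∑' k, g k ≤ 1 / 2) (hA : NoSmallSolution A w) :
    NoSmallSolution (fun n => A n + B n) w := by
  rintro x hx ⟨C, hC⟩
  have hC0 : 0 ≤ C := nonneg_of_mul_nonneg_left ((norm_nonneg _).trans (hC 0)) (hw 0)
  have hs := hK.summable hg hC hC0
  have h0 := hA (fun m => x m - ∑' k, G m (k + 1) * B k * x k) (fun m => by
      rw [hG.tsum_succ hs, hx m, add_mul, mul_sub]
      abel)
    ⟨C + C / 2, fun m => by
      rw [add_mul]
      exact (norm_sub_le _ _).trans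
        (add_le_add (hC m) (hK.norm_tsum_le hg hw hg2 hC hC0 m))⟩
  exact hK.eq_zero hg hw hg2 hC fun m => sub_eq_zero.1 (h0 m)

end Perturbation

/-! ### Green function identities from uniqueness -/

section FromLeft

variable {A : ℤ → R} {H : ℤ → ℤ → R} {w : ℤ → ℝ}

/-- For fixed `n`, the difference of the two sides of the right recursion is a dominated solution in
`m`. -/
theorem IsGreen.of_left
    (left : ∀ m n, H (m + 1) n = A m * H m n + if m + 1 = n then 1 else 0)
    (hw : ∀ m, 0 < w m) (hA : NoSmallSolution A w) (hH : ∀ n, ∃ C, ∀ m, ‖H m n‖ ≤ C * w m) :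
    IsGreen A H := by
  refine ⟨left, fun m n => ?_⟩
  obtain ⟨C₁, h₁⟩ := hH n
  obtain ⟨C₂, h₂⟩ := hH (n + 1)
  refine (sub_eq_zero.1 (hA (fun m => H m (n + 1) * A n + (if m = n then 1 else 0) - H m n)
    (fun m => ?_) ⟨C₂ * ‖A n‖ + ‖(1 : R)‖ / w n + C₁, fun m => ?_⟩ m)).symm
  · rw [left m n, left m (n + 1)]
    by_cases h : m = n
    · subst h
      simp
      noncomm_ring
    · rw [if_neg (show ¬ m + 1 = n + 1 by omega), if_neg h]
      noncomm_ring
  · refine (norm_sub_le _ _).trans ?_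
    rw [add_mul]
    refine add_le_add ((norm_add_le _ _).trans ?_) (h₁ m)
    rw [add_mul]
    refine add_le_add ?_ ?_
    · refine (norm_mul_le _ _).trans ?_
      calc ‖H m (n + 1)‖ * ‖A n‖ ≤ C₂ * w m * ‖A n‖ :=
            mul_le_mul_of_nonneg_right (h₂ m) (norm_nonneg _)
        _ = C₂ * ‖A n‖ * w m := by ring
    · split_ifs with h
      · subst h
        rw [div_mul_cancel₀ _ (hw m).ne']
      · rw [norm_zero]
        have := hw n
        have := hw m
        positivity

/-- The difference of the two sides solves the homogeneous equation, even across `m + 1 = n`, where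
`A m * H m n = H n n - 1`. The case `m = n` is idempotence. -/
theorem IsGreen.mul_diag (hH : IsGreen A H) (hw : ∀ m, 0 < w m) (hA : NoSmallSolution A w)
    {n : ℤ} (hbd : ∃ C, ∀ m, ‖H m n‖ ≤ C * w m) (m : ℤ) :
    H m n * H n n = if n ≤ m then H m n else 0 := by
  obtain ⟨C, hC⟩ := hbd
  have hC0 : 0 ≤ C := nonneg_of_mul_nonneg_left ((norm_nonneg _).trans (hC 0)) (hw 0)
  refine (sub_eq_zero.1 (hA (fun m => (if n ≤ m then H m n else 0) - H m n * H n n)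
    (fun m => ?_) ⟨C + C * ‖H n n‖, fun m => ?_⟩ m)).symm
  · rcases lt_trichotomy (m + 1) n with h | h | h
    · rw [if_neg (by omega), if_neg (by omega), hH.left m n, if_neg (by omega)]
      noncomm_ring
    · subst h
      have e := hH.left m (m + 1)
      rw [if_pos rfl] at e
      rw [if_pos le_rfl, if_neg (by omega), zero_sub, mul_neg, ← mul_assoc, eq_sub_of_add_eq e.symm]
      noncomm_ring
    · rw [if_pos (by omega), if_pos (by omega), hH.left m n, if_neg (by omega)]
      noncomm_ring
  · rw [add_mul]
    refine (norm_sub_le _ _).trans (add_le_add ?_ ?_)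
    · split_ifs
      · exact hC m
      · rw [norm_zero]
        exact mul_nonneg hC0 (hw m).le
    · refine (norm_mul_le _ _).trans ?_
      calc ‖H m n‖ * ‖H n n‖ ≤ C * w m * ‖H n n‖ :=
            mul_le_mul_of_nonneg_right (hC m) (norm_nonneg _)
        _ = C * ‖H n n‖ * w m := by ring

end FromLeft

end Ring

/-! ### Evolution operators and the Green function of a dichotomy -/

section Evolution

variable {𝕜 X : Type*} [RCLike 𝕜] [NormedAddCommGroup X] [NormedSpace 𝕜 X]
variable {A P : ℤ → X →L[𝕜] X}

theorem evol_self (A : ℤ → X →L[𝕜] X) (n : ℤ) : evol A n n = 1 := by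
  simp only [evol, sub_self]
  rfl

theorem evol_succ (A : ℤ → X →L[𝕜] X) {m n : ℤ} (h : n ≤ m) :
    evol A (m + 1) n = A m * evol A m n := by
  have e : (m + 1 - n).toNat = (m - n).toNat + 1 := by omega
  have e' : n + ((m - n).toNat : ℤ) = m := by omega
  rw [evol, e, iter, e']
  rfl

theorem evol_eq_mul (A : ℤ → X →L[𝕜] X) {m n : ℤ} (h : n + 1 ≤ m) :
    evol A m n = evol A m (n + 1) * A n := by
  induction m, h using Int.leInduction with
  | base => rw [evol_succ A le_rfl, evol_self, evol_self, one_mul, mul_one]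
  | succ m hm ih => rw [evol_succ A (by omega), ih, evol_succ A hm, mul_assoc]

theorem evol_succ_self (A : ℤ → X →L[𝕜] X) (n : ℤ) : evol A (n + 1) n = A n := by
  rw [evol_succ A le_rfl, evol_self, mul_one]

theorem isInvertible_kerRestrict_evol {comm : ∀ n, (A n).comp (P n) = (P (n + 1)).comp (A n)}
    (inv : ∀ n, (kerRestrict (A n) (P n) (P (n + 1)) (comm n)).IsInvertible) {m n : ℤ}
    (hmn : m ≤ n) :
    (kerRestrict (evol A n m) (P m) (P n) (evol_comm comm hmn)).IsInvertible := by
  induction n, hmn using Int.leInduction with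
  | base =>
    have : kerRestrict (evol A m m) (P m) (P m) (evol_comm comm le_rfl) =
        ContinuousLinearMap.id 𝕜 (P m).ker := by
      ext v
      change evol A m m v = v
      rw [evol_self]
      rfl
    rw [this]
    exact ContinuousLinearMap.isInvertible_equiv (f := ContinuousLinearEquiv.refl 𝕜 (P m).ker)
  | succ n hn ih =>
    have : kerRestrict (evol A (n + 1) m) (P m) (P (n + 1)) (evol_comm comm (by omega)) =
        (kerRestrict (A n) (P n) (P (n + 1)) (comm n)).comp
          (kerRestrict (evol A n m) (P m) (P n) (evol_comm comm hn)) := by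
      ext v
      change evol A (n + 1) m v = A n (evol A n m v)
      rw [evol_succ A hn]
      rfl
    rw [this]
    exact (inv n).comp ih

/-- The backward evolution on the kernels, precomposed with `Id - P_n`, as an operator on `X`. -/
noncomputable def backProj (A P : ℤ → X →L[𝕜] X)
    (comm : ∀ n, (A n).comp (P n) = (P (n + 1)).comp (A n)) (proj : ∀ n, (P n).comp (P n) = P n)
    {m n : ℤ} (hmn : m ≤ n) : X →L[𝕜] X :=
  (P m).ker.subtypeL.comp ((backEvol A P comm hmn).comp (complProj (P n) (proj n)))

/-- Characterizes the backward evolution by its range and its forward image, so that later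
identities need no manipulation of inverses. -/
theorem backProj_unique {comm : ∀ n, (A n).comp (P n) = (P (n + 1)).comp (A n)}
    (proj : ∀ n, (P n).comp (P n) = P n) {m n : ℤ} (hmn : m ≤ n)
    (inv : (kerRestrict (evol A n m) (P m) (P n) (evol_comm comm hmn)).IsInvertible)
    {T S : X →L[𝕜] X} (h1 : P m * T = 0) (h2 : evol A n m * T = (1 - P n) * S) :
    T = backProj A P comm proj hmn * S := by
  ext v
  have hv : P m (T v) = 0 := DFunLike.congr_fun h1 v
  let u : (P m).ker := ⟨T v, hv⟩
  have hu : kerRestrict (evol A n m) (P m) (P n) (evol_comm comm hmn) u =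
      complProj (P n) (proj n) (S v) := Subtype.ext (DFunLike.congr_fun h2 v)
  have := inv.inverse_apply_self u
  rw [hu] at this
  exact (congrArg Subtype.val this).symm

theorem mul_backProj {comm : ∀ n, (A n).comp (P n) = (P (n + 1)).comp (A n)}
    (proj : ∀ n, (P n).comp (P n) = P n) {m n : ℤ} (hmn : m ≤ n) :
    P m * backProj A P comm proj hmn = 0 := by
  ext v
  exact (backEvol A P comm hmn (complProj (P n) (proj n) v)).2

theorem evol_mul_backProj {comm : ∀ n, (A n).comp (P n) = (P (n + 1)).comp (A n)}
    (proj : ∀ n, (P n).comp (P n) = P n) {m n : ℤ} (hmn : m ≤ n)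
    (inv : (kerRestrict (evol A n m) (P m) (P n) (evol_comm comm hmn)).IsInvertible) :
    evol A n m * backProj A P comm proj hmn = 1 - P n := by
  ext v
  exact congrArg Subtype.val (inv.self_apply_inverse (complProj (P n) (proj n) v))

/-- The Green function of a dichotomy. -/
noncomputable def green (A P : ℤ → X →L[𝕜] X)
    (comm : ∀ n, (A n).comp (P n) = (P (n + 1)).comp (A n)) (proj : ∀ n, (P n).comp (P n) = P n)
    (m n : ℤ) : X →L[𝕜] X :=
  if h : n ≤ m then evol A m n * P n else -backProj A P comm proj (le_of_not_ge h)

variable {μ ν : ℤ → ℝ} {D lam : ℝ}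

theorem IsDichotomy.green_eq_of_le (h : IsDichotomy μ ν A P D lam) {m n : ℤ} (hmn : n ≤ m) :
    green A P h.comm h.proj m n = evol A m n * P n := dif_pos hmn

theorem IsDichotomy.green_eq_of_lt (h : IsDichotomy μ ν A P D lam) {m n : ℤ} (hmn : m < n) :
    green A P h.comm h.proj m n = -backProj A P h.comm h.proj hmn.le := dif_neg (by omega)

theorem IsDichotomy.backProj_self (h : IsDichotomy μ ν A P D lam) (n : ℤ) :
    backProj A P h.comm h.proj (le_refl n) = 1 - P n := by
  have := evol_mul_backProj (comm := h.comm) h.proj le_rfl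
    (isInvertible_kerRestrict_evol h.invertible (le_refl n))
  rwa [evol_self, one_mul] at this

theorem IsDichotomy.mul_backProj_succ (h : IsDichotomy μ ν A P D lam) {m n : ℤ}
    (hmn : m + 1 ≤ n) :
    A m * backProj A P h.comm h.proj (show m ≤ n by omega) = backProj A P h.comm h.proj hmn := by
  have hb := fun {m n : ℤ} (hmn : m ≤ n) => isInvertible_kerRestrict_evol h.invertible hmn
  rw [← mul_one (backProj A P h.comm h.proj hmn)]
  refine backProj_unique h.proj hmn (hb hmn) ?_ ?_
  · have e : A m * P m = P (m + 1) * A m := h.comm m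
    rw [← mul_assoc, ← e, mul_assoc, mul_backProj, mul_zero]
  · rw [← mul_assoc, ← evol_eq_mul A hmn, evol_mul_backProj _ _ (hb (by omega)), mul_one]

theorem IsDichotomy.backProj_succ_mul (h : IsDichotomy μ ν A P D lam) {m n : ℤ} (hmn : m ≤ n) :
    backProj A P h.comm h.proj hmn =
      backProj A P h.comm h.proj (show m ≤ n + 1 by omega) * A n := by
  have hb := fun {m n : ℤ} (hmn : m ≤ n) => isInvertible_kerRestrict_evol h.invertible hmn
  refine backProj_unique h.proj (by omega) (hb (by omega)) (mul_backProj _ _) ?_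
  have e : A n * P n = P (n + 1) * A n := h.comm n
  rw [evol_succ A hmn, mul_assoc, evol_mul_backProj _ _ (hb (by omega)), mul_sub, sub_mul, e, mul_one,
    one_mul]

theorem IsDichotomy.isGreen (h : IsDichotomy μ ν A P D lam) :
    IsGreen A (green A P h.comm h.proj) := by
  constructor
  · intro m n
    rcases lt_trichotomy (m + 1) n with hn | hn | hn
    · rw [if_neg hn.ne, h.green_eq_of_lt hn, h.green_eq_of_lt (by omega), mul_neg,
        h.mul_backProj_succ hn.le, add_zero]
    · subst hn
      rw [if_pos rfl, h.green_eq_of_le le_rfl, h.green_eq_of_lt (by omega), mul_neg,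
        h.mul_backProj_succ le_rfl, h.backProj_self, evol_self]
      noncomm_ring
    · rw [if_neg hn.ne', h.green_eq_of_le hn.le, h.green_eq_of_le (by omega),
        evol_succ A (by omega), add_zero, mul_assoc]
  · intro m n
    have e : A n * P n = P (n + 1) * A n := h.comm n
    rcases lt_trichotomy m n with hn | hn | hn
    · rw [if_neg hn.ne, h.green_eq_of_lt hn, h.green_eq_of_lt (by omega), neg_mul,
        ← h.backProj_succ_mul hn.le, add_zero]
    · subst hn
      rw [if_pos rfl, h.green_eq_of_le le_rfl, h.green_eq_of_lt (by omega), neg_mul,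
        ← h.backProj_succ_mul le_rfl, h.backProj_self, evol_self]
      noncomm_ring
    · rw [if_neg hn.ne', h.green_eq_of_le hn.le, h.green_eq_of_le (by omega),
        evol_eq_mul A hn, add_zero, mul_assoc, mul_assoc, e]

theorem rpow_neg_div_eq_exp (hμ : ∀ n, 0 < μ n) (a : ℝ) (m n : ℤ) :
    (μ m / μ n) ^ (-a) = Real.exp (-a * (Real.log (μ m) - Real.log (μ n))) := by
  rw [Real.rpow_def_of_pos (div_pos (hμ m) (hμ n)), Real.log_div (hμ m).ne' (hμ n).ne', mul_comm]

theorem log_growthRate_le (hμ : IsGrowthRate μ) {m n : ℤ} (h : m ≤ n) :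
    Real.log (μ m) ≤ Real.log (μ n) :=
  Real.log_le_log (hμ.pos m) (hμ.strictMono.monotone h)

theorem IsDichotomy.norm_green_le (h : IsDichotomy μ ν A P D lam) (hμ : IsGrowthRate μ)
    (m n : ℤ) : ‖green A P h.comm h.proj m n‖ ≤
      D * ν n * Real.exp (-lam * |Real.log (μ m) - Real.log (μ n)|) := by
  rcases le_or_gt n m with hn | hn
  · rw [h.green_eq_of_le hn, abs_of_nonneg (sub_nonneg.2 (log_growthRate_le hμ hn)),
      ← rpow_neg_div_eq_exp hμ.pos]
    exact h.stable m n hn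
  · rw [h.green_eq_of_lt hn, norm_neg, abs_sub_comm,
      abs_of_nonneg (sub_nonneg.2 (log_growthRate_le hμ hn.le)), ← rpow_neg_div_eq_exp hμ.pos]
    exact h.unstable m n hn.le

/-! ### Algebraic consequences of the Green relations -/

section Converse

variable {H : ℤ → ℤ → X →L[𝕜] X}

theorem IsGreen.eq_evol_mul (hH : IsGreen A H) {m n : ℤ} (hmn : n ≤ m) :
    H m n = evol A m n * H n n := by
  induction m, hmn using Int.leInduction with
  | base => rw [evol_self, one_mul]
  | succ m hm ih => rw [hH.left, if_neg (by omega), add_zero, ih, evol_succ A hm, mul_assoc]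

theorem IsGreen.diag_eq_evol_mul (hH : IsGreen A H) {m n : ℤ} (hmn : m + 1 ≤ n) :
    H n n = evol A n m * H m n + 1 := by
  have key : ∀ k, m ≤ k → k + 1 ≤ n → H k n = evol A k m * H m n := by
    intro k hk
    induction k, hk using Int.leInduction with
    | base => intro _; rw [evol_self, one_mul]
    | succ k hk ih =>
      intro hkn
      rw [hH.left, if_neg (by omega), add_zero, ih (by omega), evol_succ A hk, mul_assoc]
  have e := hH.left (n - 1) n
  rw [if_pos (by omega), key (n - 1) (by omega) (by omega), ← mul_assoc,
    ← evol_succ A (by omega), sub_add_cancel] at e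
  exact e

theorem IsGreen.diag_eq_mul_evol (hH : IsGreen A H) {m n : ℤ} (hmn : m + 1 ≤ n) :
    H m m = H m n * evol A n m + 1 := by
  induction n, hmn using Int.leInduction with
  | base => rw [hH.right m m, if_pos rfl, evol_succ_self]
  | succ n hn ih =>
    rw [ih, hH.right m n, if_neg (by omega), add_zero, evol_succ A (by omega), mul_assoc]

theorem IsGreen.comm (hH : IsGreen A H) (n : ℤ) :
    (A n).comp (H n n) = (H (n + 1) (n + 1)).comp (A n) := by
  have h1 := hH.left n n
  have h2 := hH.right (n + 1) n
  rw [if_neg (by omega), add_zero] at h1 h2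
  exact h1.symm.trans h2

/-- Writing `E = evol A n m`, one has `H m m = H m n * E + 1` and `E * H m n = H n n - 1`, so the
product collapses to `H m n * H n n = 0`. -/
theorem IsGreen.diag_mul_eq_zero (hH : IsGreen A H)
    (hdiag : ∀ m n, H m n * H n n = if n ≤ m then H m n else 0) {m n : ℤ} (hmn : m < n) :
    H m m * H m n = 0 := by
  have e := eq_sub_of_add_eq (hH.diag_eq_evol_mul (m := m) (n := n) (by omega)).symm
  have e' := hdiag m n
  rw [if_neg (by omega)] at e'
  rw [hH.diag_eq_mul_evol (show m + 1 ≤ n by omega), add_mul, mul_assoc, e, mul_sub, e']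
  noncomm_ring

end Converse

end Evolution

/-! ### From a Green function to a dichotomy -/

section Construction

variable {𝕜 X : Type*} [RCLike 𝕜] [NormedAddCommGroup X] [NormedSpace 𝕜 X]
variable {A P : ℤ → X →L[𝕜] X} {H : ℤ → ℤ → X →L[𝕜] X} {μ ν : ℤ → ℝ} {D lam : ℝ}

/-- The inverse is `-H n (n + 1)`: on the kernels the diagonal terms vanish from the left relation
at `(n, n + 1)` and the right one at `(n, n)`. -/
theorem IsGreen.isInvertible (hH : IsGreen A H)
    (hdiag : ∀ m n, H m n * H n n = if n ≤ m then H m n else 0) (n : ℤ) :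
    (kerRestrict (A n) (H n n) (H (n + 1) (n + 1)) (hH.comm n)).IsInvertible := by
  have h1 := hH.diag_mul_eq_zero hdiag (show n < n + 1 by omega)
  have h2 := hH.left n (n + 1)
  have h3 := hH.right n n
  rw [if_pos rfl] at h2 h3
  refine ContinuousLinearMap.IsInvertible.of_inverse
    (g := ((-H n (n + 1)).comp (H (n + 1) (n + 1)).ker.subtypeL).codRestrict (H n n).ker
      fun v => ?_) ?_ ?_
  · have : H n n (H n (n + 1) (v : X)) = 0 := DFunLike.congr_fun h1 (v : X)
    change H n n (-H n (n + 1) (v : X)) = 0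
    rw [map_neg, this, neg_zero]
  · ext v
    have hv : H (n + 1) (n + 1) (v : X) = 0 := v.2
    have e : H (n + 1) (n + 1) (v : X) = A n (H n (n + 1) (v : X)) + v :=
      DFunLike.congr_fun h2 (v : X)
    change A n (-H n (n + 1) (v : X)) = v
    rw [hv] at e
    rw [map_neg, neg_eq_iff_add_eq_zero]
    exact e.symm
  · ext v
    have hv : H n n (v : X) = 0 := v.2
    have e : H n n (v : X) = H n (n + 1) (A n (v : X)) + v := DFunLike.congr_fun h3 (v : X)
    change -H n (n + 1) (A n (v : X)) = v
    rw [hv] at e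
    rw [neg_eq_iff_add_eq_zero]
    exact e.symm

theorem IsGreen.isDichotomy (hH : IsGreen A H) (hμ : IsGrowthRate μ) (hν : ∀ n, 1 ≤ ν n)
    (hD : 0 < D) (hlam : 0 < lam)
    (hdiag : ∀ m n, H m n * H n n = if n ≤ m then H m n else 0)
    (hbd : ∀ m n, ‖H m n‖ ≤
      D * ν n * Real.exp (-lam * |Real.log (μ m) - Real.log (μ n)|)) :
    IsDichotomy μ ν A (fun n => H n n) (1 + D) lam := by
  have hproj : ∀ n, (H n n).comp (H n n) = H n n := fun n =>
    (hdiag n n).trans (if_pos le_rfl)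
  have hinv := hH.isInvertible hdiag
  have hle : ∀ m n, ‖H m n‖ ≤
      (1 + D) * ν n * Real.exp (-lam * |Real.log (μ m) - Real.log (μ n)|) := fun m n => by
    refine (hbd m n).trans (mul_le_mul_of_nonneg_right ?_ (Real.exp_pos _).le)
    have := hν n
    nlinarith
  refine ⟨by positivity, hlam, hproj, hH.comm, hinv, fun m n hmn => ?_, fun m n hmn => ?_⟩
  · change ‖evol A m n * H n n‖ ≤ _
    rw [← hH.eq_evol_mul hmn, rpow_neg_div_eq_exp hμ.pos,
      ← abs_of_nonneg (sub_nonneg.2 (log_growthRate_le hμ hmn))]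
    exact hle m n
  · have hb := isInvertible_kerRestrict_evol (P := fun n => H n n) (comm := hH.comm) hinv hmn
    change ‖backProj A (fun n => H n n) hH.comm hproj hmn‖ ≤ _
    rw [rpow_neg_div_eq_exp hμ.pos, ← abs_of_nonneg (sub_nonneg.2 (log_growthRate_le hμ hmn)),
      abs_sub_comm]
    -- Only the diagonal needs the extra `1` in `1 + D`: there the operator is `1 - H m m` rather
    -- than `-H m n`.
    rcases hmn.eq_or_lt with rfl | hlt
    · have e := evol_mul_backProj (P := fun n => H n n) (comm := hH.comm) hproj hmn hb
      rw [evol_self, one_mul] at e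
      rw [e]
      have h1 : ‖(1 : X →L[𝕜] X)‖ ≤ 1 := ContinuousLinearMap.norm_id_le
      have h2 := hbd m m
      have h3 := hν m
      rw [sub_self, abs_zero, mul_zero, Real.exp_zero, mul_one] at h2 ⊢
      refine (norm_sub_le _ _).trans ?_
      linarith
    · have e : -H m n = backProj A (fun n => H n n) hH.comm hproj hmn * 1 := by
        refine backProj_unique hproj hmn hb ?_ ?_
        · simp only [mul_neg]
          rw [hH.diag_mul_eq_zero hdiag hlt, neg_zero]
        · rw [hH.diag_eq_evol_mul (show m + 1 ≤ n by omega)]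
          noncomm_ring
      rw [mul_one] at e
      rw [← e, norm_neg]
      exact hle m n

end Construction

/-! ### Exponential weights and the perturbation estimate -/

section Weights

variable {μ ν : ℤ → ℝ}

theorem IsGrowthRate.tendsto_abs_log_atTop (hμ : IsGrowthRate μ) :
    Tendsto (fun n => |Real.log (μ n)|) atTop atTop :=
  tendsto_abs_atTop_atTop.comp (Real.tendsto_log_atTop.comp hμ.tendsto_atTop)

theorem IsGrowthRate.tendsto_abs_log_atBot (hμ : IsGrowthRate μ) :
    Tendsto (fun n => |Real.log (μ n)|) atBot atTop :=
  tendsto_abs_atBot_atTop.comp (Real.tendsto_log_nhdsGT_zero.comp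
    (tendsto_nhdsWithin_iff.2 ⟨hμ.tendsto_atBot, Eventually.of_forall hμ.pos⟩))

theorem IsGrowthRate.exists_bound (hμ : IsGrowthRate μ) {ε : ℝ} (hε : 0 ≤ ε)
    (hneg : BddAbove (Set.range fun n : ℕ => μ (-(n : ℤ)) ^ ε * ν (-(n : ℤ))))
    (hpos : BddAbove (Set.range fun n : ℕ => μ (n : ℤ) ^ (-ε) * ν (n : ℤ))) :
    ∃ M, ∀ n, ν n ≤ M * Real.exp (ε * |Real.log (μ n)|) := by
  obtain ⟨M₁, h₁⟩ := hneg
  obtain ⟨M₂, h₂⟩ := hpos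
  -- Used with `s = ε` for nonnegative indices and `s = -ε` for nonpositive ones.
  have key : ∀ (n : ℤ) (s M : ℝ), |s| ≤ ε → μ n ^ (-s) * ν n ≤ M →
      ν n ≤ |M| * Real.exp (ε * |Real.log (μ n)|) := by
    intro n s M hs h
    have hp := Real.rpow_pos_of_pos (hμ.pos n) s
    rw [Real.rpow_neg (hμ.pos n).le, inv_mul_le_iff₀ hp] at h
    calc ν n ≤ μ n ^ s * M := h
      _ ≤ μ n ^ s * |M| := mul_le_mul_of_nonneg_left (le_abs_self M) hp.le
      _ = |M| * Real.exp (Real.log (μ n) * s) := by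
        rw [Real.rpow_def_of_pos (hμ.pos n), mul_comm]
      _ ≤ |M| * Real.exp (ε * |Real.log (μ n)|) := by
        refine mul_le_mul_of_nonneg_left (Real.exp_le_exp.2 ?_) (abs_nonneg M)
        refine (le_abs_self _).trans ?_
        rw [abs_mul, mul_comm]
        exact mul_le_mul_of_nonneg_right hs (abs_nonneg _)
  refine ⟨max |M₁| |M₂|, fun n => ?_⟩
  rcases Int.eq_nat_or_neg n with ⟨k, rfl | rfl⟩
  · exact (key k ε M₂ (abs_of_nonneg hε).le (h₂ ⟨k, rfl⟩)).trans
      (mul_le_mul_of_nonneg_right (le_max_right _ _) (Real.exp_pos _).le)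
  · refine (key (-k) (-ε) M₁ (by rw [abs_neg, abs_of_nonneg hε]) ?_).trans
      (mul_le_mul_of_nonneg_right (le_max_left _ _) (Real.exp_pos _).le)
    rw [neg_neg]
    exact h₁ ⟨k, rfl⟩

variable {𝕜 X : Type*} [RCLike 𝕜] [NormedAddCommGroup X] [NormedSpace 𝕜 X]
variable {A B P : ℤ → X →L[𝕜] X} {D lam : ℝ}

/-- The growth of `ν` enters here: `‖G m n‖` still decays like `exp(-(λ - ε)|log μ_n|)` in its
second index. -/
theorem IsDichotomy.noSmallSolution (h : IsDichotomy μ ν A P D lam) (hμ : IsGrowthRate μ)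
    {ε M β : ℝ} (hε : ε < lam) (hβ : 0 < β)
    (hν : ∀ n, ν n ≤ M * Real.exp (ε * |Real.log (μ n)|)) :
    NoSmallSolution A fun m => Real.exp (-β * |Real.log (μ m)|) := by
  have hle : ∀ m n, ‖‖green A P h.comm h.proj m n‖ * Real.exp (-β * |Real.log (μ n)|)‖ ≤
      D * |M| * Real.exp (lam * |Real.log (μ m)|) *
        Real.exp (-((lam - ε) * |Real.log (μ n)|)) := by
    intro m n
    have h1 : Real.exp (-β * |Real.log (μ n)|) ≤ 1 :=
      Real.exp_le_one_iff.2 (by nlinarith [abs_nonneg (Real.log (μ n))])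
    have hD := h.D_pos
    have h2 : ν n ≤ |M| * Real.exp (ε * |Real.log (μ n)|) := (hν n).trans
      (mul_le_mul_of_nonneg_right (le_abs_self M) (Real.exp_pos _).le)
    rw [norm_mul, norm_norm, Real.norm_of_nonneg (Real.exp_pos _).le]
    calc _ ≤ ‖green A P h.comm h.proj m n‖ * 1 :=
          mul_le_mul_of_nonneg_left h1 (norm_nonneg _)
      _ = ‖green A P h.comm h.proj m n‖ := mul_one _
      _ ≤ D * ν n * Real.exp (-lam * |Real.log (μ m) - Real.log (μ n)|) :=
          h.norm_green_le hμ m n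
      _ ≤ D * (|M| * Real.exp (ε * |Real.log (μ n)|)) *
          Real.exp (lam * |Real.log (μ m)| - lam * |Real.log (μ n)|) := by
        gcongr ?_ * ?_
        · exact mul_le_mul_of_nonneg_left h2 hD.le
        · refine Real.exp_le_exp.2 ?_
          have := abs_sub_abs_le_abs_sub (Real.log (μ n)) (Real.log (μ m))
          rw [abs_sub_comm] at this
          nlinarith [h.lam_pos]
      _ = _ := by
        rw [mul_assoc, mul_assoc, ← Real.exp_add, mul_assoc, mul_assoc, ← Real.exp_add]
        ring_nf
  have hlim : ∀ (l : Filter ℤ), Tendsto (fun n => |Real.log (μ n)|) l atTop → ∀ m,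
      Tendsto (fun n => ‖green A P h.comm h.proj m n‖ * Real.exp (-β * |Real.log (μ n)|)) l
        (𝓝 0) := by
    intro l hl m
    refine squeeze_zero_norm (hle m) ?_
    have := (Real.tendsto_exp_neg_atTop_nhds_zero.comp
      (hl.const_mul_atTop (sub_pos.2 hε))).const_mul (D * |M| * Real.exp (lam * |Real.log (μ m)|))
    simpa using this
  exact h.isGreen.noSmallSolution (hlim _ hμ.tendsto_abs_log_atTop)
    (hlim _ hμ.tendsto_abs_log_atBot)

/-- The bound on `B k` is tailored to this: `ν (k + 1)` cancels the factor in the Green estimate,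
and the quotient of powers of `μ` pays for the shift from `k + 1` to `k`. The triangle inequality in
`log μ` does the rest, uniformly in `t`. -/
theorem IsDichotomy.kernelBound (h : IsDichotomy μ ν A P D lam) (hμ : IsGrowthRate μ)
    (hν : ∀ n, 1 ≤ ν n) {β : ℝ} (hβ : 0 ≤ β) (hβlam : β ≤ lam) {g : ℤ → ℝ} (hg : ∀ n, 0 ≤ g n)
    (hB : ∀ n, ‖B n‖ ≤ g n * μ n ^ β / (ν (n + 1) * μ (n + 1) ^ β)) (t : ℝ) :
    KernelBound (fun m k => green A P h.comm h.proj m (k + 1) * B k)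
      (fun m => Real.exp (-β * |Real.log (μ m) - t|)) fun k => D * g k := by
  intro m k
  have hD := h.D_pos
  have hν0 : 0 < ν (k + 1) := zero_lt_one.trans_le (hν _)
  have hB' : ‖B k‖ ≤ g k / ν (k + 1) *
      Real.exp (-β * |Real.log (μ (k + 1)) - Real.log (μ k)|) := by
    rw [abs_of_nonneg (sub_nonneg.2 (log_growthRate_le hμ (by omega))),
      ← rpow_neg_div_eq_exp hμ.pos, Real.rpow_neg (div_pos (hμ.pos _) (hμ.pos _)).le,
      Real.div_rpow (hμ.pos _).le (hμ.pos _).le, inv_div, div_mul_div_comm]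
    exact hB k
  have hG := h.norm_green_le hμ m (k + 1)
  calc ‖green A P h.comm h.proj m (k + 1) * B k‖ * Real.exp (-β * |Real.log (μ k) - t|)
      ≤ (D * ν (k + 1) * Real.exp (-lam * |Real.log (μ m) - Real.log (μ (k + 1))|)) *
          (g k / ν (k + 1) * Real.exp (-β * |Real.log (μ (k + 1)) - Real.log (μ k)|)) *
          Real.exp (-β * |Real.log (μ k) - t|) := by
        refine mul_le_mul_of_nonneg_right ((norm_mul_le _ _).trans ?_) (Real.exp_pos _).le
        exact mul_le_mul hG hB' (norm_nonneg _) (by positivity)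
    _ = D * g k * Real.exp (-lam * |Real.log (μ m) - Real.log (μ (k + 1))| +
          -β * |Real.log (μ (k + 1)) - Real.log (μ k)| + -β * |Real.log (μ k) - t|) := by
        rw [Real.exp_add, Real.exp_add]
        field_simp
    _ ≤ D * g k * Real.exp (-β * |Real.log (μ m) - t|) := by
        refine mul_le_mul_of_nonneg_left (Real.exp_le_exp.2 ?_) (mul_nonneg hD.le (hg k))
        have h1 := abs_sub_le (Real.log (μ m)) (Real.log (μ (k + 1))) t
        have h2 := abs_sub_le (Real.log (μ (k + 1))) (Real.log (μ k)) t
        have h3 := mul_le_mul_of_nonneg_right hβlam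
          (abs_nonneg (Real.log (μ m) - Real.log (μ (k + 1))))
        have h4 := mul_le_mul_of_nonneg_left (h1.trans (add_le_add_right h2 _)) hβ
        linarith

theorem IsDichotomy.perturb [CompleteSpace X] (h : IsDichotomy μ ν A P D lam)
    (hμ : IsGrowthRate μ) (hν : ∀ n, 1 ≤ ν n) {ε M β : ℝ} (hε : ε < lam)
    (hM : ∀ n, ν n ≤ M * Real.exp (ε * |Real.log (μ n)|)) (hβ : 0 < β) (hβlam : β ≤ lam)
    {g : ℤ → ℝ} (hg : ∀ n, 0 ≤ g n) (hgs : Summable g) (hg2 : D * ∑' k, g k ≤ 1 / 2)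
    (hB : ∀ n, ‖B n‖ ≤ g n * μ n ^ β / (ν (n + 1) * μ (n + 1) ^ β)) :
    AdmitsDichotomy μ ν fun n => A n + B n := by
  have hK := h.kernelBound hμ hν hβ.le hβlam hg hB
  have hgs' := hgs.mul_left D
  rw [← tsum_mul_left] at hg2
  have hG := h.isGreen
  have hD := h.D_pos
  have hex : ∀ n, ∃ φ : ℤ → X →L[𝕜] X,
      (∀ m, ‖φ m‖ ≤ 2 * (D * ν n) * Real.exp (-β * |Real.log (μ m) - Real.log (μ n)|)) ∧
      ∀ m, φ (m + 1) = (A m + B m) * φ m + if m + 1 = n then 1 else 0 := by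
    intro n
    refine hG.exists_perturbed_column (hK (Real.log (μ n))) hgs' (fun _ => Real.exp_pos _) hg2 n
      fun m => (h.norm_green_le hμ m n).trans ?_
    have := hν n
    refine mul_le_mul_of_nonneg_left (Real.exp_le_exp.2 ?_) (by positivity)
    exact mul_le_mul_of_nonneg_right (neg_le_neg hβlam) (abs_nonneg _)
  choose φ hφ hrec using hex
  -- Uniqueness uses the fixed centre `0`, so that columns with different `n` can be compared;
  -- recentring costs only a constant depending on `n`.
  have hu : NoSmallSolution (fun n => A n + B n)
      fun m => Real.exp (-β * |Real.log (μ m) - 0|) :=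
    hG.noSmallSolution_add (hK 0) hgs' (fun _ => Real.exp_pos _) hg2 (by
      simpa using h.noSmallSolution hμ hε hβ hM)
  have hdom : ∀ n, ∃ C, ∀ m, ‖φ n m‖ ≤ C * Real.exp (-β * |Real.log (μ m) - 0|) := by
    intro n
    refine ⟨2 * (D * ν n) * Real.exp (β * |Real.log (μ n)|), fun m => (hφ n m).trans ?_⟩
    have := hν n
    rw [mul_assoc _ (Real.exp _) (Real.exp _), ← Real.exp_add, sub_zero]
    refine mul_le_mul_of_nonneg_left (Real.exp_le_exp.2 ?_) (by positivity)
    have := mul_le_mul_of_nonneg_left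
      (abs_sub_abs_le_abs_sub (Real.log (μ m)) (Real.log (μ n))) hβ.le
    linarith
  have hH : IsGreen (fun n => A n + B n) fun m n => φ n m :=
    IsGreen.of_left (fun m n => hrec n m) (fun _ => Real.exp_pos _) hu hdom
  refine ⟨fun n => φ n n, 1 + 2 * D, β, hH.isDichotomy hμ hν (by positivity) hβ
    (fun m n => hH.mul_diag (fun _ => Real.exp_pos _) hu (hdom n) m) fun m n => ?_⟩
  rw [mul_assoc 2 D]
  exact hφ n m

end Weights

end MuNu

theorem mainTheorem7 {𝕜 X : Type*} [RCLike 𝕜] [NormedAddCommGroup X] [NormedSpace 𝕜 X]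
    [CompleteSpace X]
    (μ ν : ℤ → ℝ) (hμ : MuNu.IsGrowthRate μ) (hν : ∀ n, 1 ≤ ν n)
    (A P : ℤ → X →L[𝕜] X) (D lam : ℝ) (hA : MuNu.IsDichotomy μ ν A P D lam)
    (ε : ℝ) (hε : 0 ≤ ε) (hεlam : ε < lam)
    (hneg : BddAbove (Set.range fun n : ℕ => μ (-(n : ℤ)) ^ ε * ν (-(n : ℤ))))
    (hpos : BddAbove (Set.range fun n : ℕ => μ (n : ℤ) ^ (-ε) * ν (n : ℤ)))
    (β : ℝ) (hβ : 0 < β) (hβlam : β < lam - ε)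
    (γ : ℤ → ℝ) (hγ : ∀ n, 0 < γ n) (hγsum : Summable γ) :
    ∃ c₀ : ℝ, 0 < c₀ ∧ ∀ c : ℝ, 0 < c → c ≤ c₀ → ∀ B : ℤ → X →L[𝕜] X,
      (∀ n, ‖B n‖ ≤ c * γ n * μ n ^ β / (ν (n + 1) * μ (n + 1) ^ β)) →
      MuNu.AdmitsDichotomy μ ν (fun n => A n + B n) := by
  have hD := hA.D_pos
  have hS : 0 < ∑' n, γ n := hγsum.tsum_pos (fun n => (hγ n).le) 0 (hγ 0)
  obtain ⟨M, hM⟩ := hμ.exists_bound hε hneg hpos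
  -- This `c₀` makes `D * ∑ c γ_n ≤ 1 / 2`, the contraction condition.
  refine ⟨1 / (2 * (D * ∑' n, γ n)), by positivity, fun c hc hcle B hB => ?_⟩
  refine hA.perturb hμ hν hεlam hM hβ (by linarith) (fun n => (mul_pos hc (hγ n)).le)
    (hγsum.mul_left c) ?_ hB
  rw [le_div_iff₀ (by positivity)] at hcle
  rw [tsum_mul_left]
  linarith
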